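/- Let $D\ge 1$ be an integer and let $\Lambda$ be Lebesgue measure on $[0,1]$. An *environment* is an array $u=(u_i^j)_{i\ge 0,\,1\le j\le D}$ in $[0,1]$; the environment law $\mathbb P$ makes all labels i.i.d. uniform on $[0,1]$. For an environment $u$ and a sequence of indices $j=(j_i)_{i\ge0}\in\{1,\dots,D\}^{\mathbb Z_{\ge0}}$ let $L(u,j)$ be the set of weak (subsequential) limit points, as $n\to\infty$, of the empirical measures $\frac1n\sum_{i=0}^{n-1}\delta_{u_i^{j_i}}$, in the space $\mathcal M_1$ of probability measures on $[0,1]$ with the weak topology. *Strategies.* A *strategy* $\chi$ is the joint law of a pair $(U,J)$ where $U$ is an environment with law $\mathbb P$ and $J=(J_i)_{i\ge 0}$ is a sequence of indices in $\{1,\dots,D\}$; thus $\frac1n\mu_{0\to n}(\chi)=\frac1n\sum_{i<n}\delta_{U_i^{J_i}}$, and $\sigma^0_\chi$ denotes the law of $U_0^{J_0}$. A *single-edge strategy* $\psi$ is the joint law of $((U^1,\dots,U^D),J)$ where $U^1,\dots,U^D$ are i.i.d. uniform on $[0,1]$ and $J$ is an index in $\{1,\dots,D\}$; $\sigma_\psi$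 is the law of $U^J$. A strategy is *independent* if it is a product $\times_{i\ge0}\psi_i$ of single-edge strategies, and *i.i.d.* if moreover all $\psi_i$ are equal. *Grid entropy.* Let $\rho$ be the Lévy–Prokhorov metric. For $\nu\in\mathcal M_1$, $\|\nu\|$ is the supremum of all $\alpha\ge0$ such that, for $\mathbb P$-almost every $u$, the $\lfloor e^{\alpha n}\rfloor$-th smallest (with multiplicity; $+\infty$ if there are fewer) of the $D^n$ values $\rho\big(\frac1n\sum_{i<n}\delta_{u_i^{\pi_i}},\nu\big)$, $\pi\in\{1,\dots,D\}^n$, tends to $0$ as $n\to\infty$; $\|\nu\|=-\infty$ if there is no such $\alpha$. Let $\mathcal R=\{\nu\in\mathcal M_1:\|\nu\|\ge0\}$ be the set of probability measures with finite grid entropy. **Theorem A.** One has $$\mathcal R=\{\sigma_\chi^0:\chi\text{ a strategy}\}=\{\sigma_\psi:\psi\text{ a single-edge strategy}\},$$ and this set is weakly closed. Almost surely it also coincides with the set of limit points of $\frac1n\mu_{0\to n}(\chi)$ over all strategies $\chi$, over all independent strategies $\chi$, and over all i.i.d. strategies $\chi$, in each of the following senses. 1. (Conditionally on the environment.) For $\mathbb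 P$-almost every $u$, $\mathcal R$ equals each of the following three sets. The first is the set of $\nu$ such that, for some Markov kernel $\kappa$ from environments to index sequences (a strategy given by the conditional law of the indices), $\nu\in L(u,j)$ for $\kappa(u)$-almost every $j$. The second is the same set with $\kappa(u)$ of the form $\bigotimes_{i}p_i(u_i)$, and the third the same set with $\kappa(u)$ of the form $\bigotimes_i p(u_i)$; here $p_i$ and $p$ are Markov kernels from $[0,1]^D$ to $\{1,\dots,D\}$ (single-edge strategies given by their conditional probabilities), chosen arbitrarily. 2. (As random sets.) Whenever an environment $U$ and, for every strategy $\chi$, an index sequence $J^\chi$ are defined on one probability space in such a way that $(U,J^\chi)$ has law $\chi$ for every $\chi$, then almost surely $$\mathcal R=\bigcup_{\chi\text{ strategy}}L(U,J^\chi)=\bigcup_{\chi\text{ independent}}L(U,J^\chi)=\overline{\bigcup_{\chi\text{ i.i.d.}}L(U,J^\chi)},$$ the bar denoting weak closure. 3. (Strategy by strategy.) $\mathcal R$ is the set of all $\nu\in\mathcal M_1$ for which there is a strategy $\chi$ such that, $\chi$-almost surely, $\nu$ is a limit point of $\frac1n\mu_{0\to n}(\chi)$; the same holds with "independent strategy"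 and with "i.i.d. strategy" in place of "strategy". -/

import Mathlib

open MeasureTheory ProbabilityTheory Filter Topology
open scoped ENNReal

/-- The possible labels `(u^1, …, u^D)` of the `D` parallel edges of a single trial. -/
abbrev Labels (D : ℕ) : Type := Fin D → unitInterval

/-- Environments `(u_i^j)`, where `i ≥ 0` is the trial and `j` the index of the edge. -/
abbrev Env (D : ℕ) : Type := ℕ → Labels D

/-- Infinite sequences of edge indices `(j_i)`, `i ≥ 0`, that is, infinite paths. -/
abbrev Indices (D : ℕ) : Type := ℕ → Fin D

/-- The law of `D` i.i.d. uniform labels. -/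
noncomputable def labelsLaw (D : ℕ) : Measure (Labels D) :=
  Measure.pi fun _ => (volume : Measure unitInterval)

/-- The law of the i.i.d. uniform environment. -/
noncomputable def envLaw (D : ℕ) : Measure (Env D) :=
  Measure.infinitePi fun _ => labelsLaw D

instance (D : ℕ) : IsProbabilityMeasure (labelsLaw D) := by
  unfold labelsLaw; infer_instance

instance (D : ℕ) : IsProbabilityMeasure (envLaw D) := by
  unfold envLaw; infer_instance

/-! ### Empirical measures and their limit points -/

/-- The empirical measure `(1/n) ∑_{i<n} δ_{x_i}` of `n` points. -/
noncomputable def empirical (n : ℕ) (x : Fin n → unitInterval) : Measure unitInterval :=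
  (n : ℝ≥0∞)⁻¹ • ∑ i, Measure.dirac (x i)

instance (n : ℕ) (x : Fin (n + 1) → unitInterval) : IsProbabilityMeasure (empirical (n + 1) x) where
  measure_univ := by
    simp only [empirical, Measure.smul_apply, Measure.finsetSum_apply, measure_univ,
      Finset.sum_const, Finset.card_univ, Fintype.card_fin, smul_eq_mul, nsmul_eq_mul, mul_one]
    exact ENNReal.inv_mul_cancel (by simp) (ENNReal.natCast_ne_top _)

/-- The empirical measure of the first `n + 1` choices `u_0^{j_0}, …, u_n^{j_n}`. -/
noncomputable def empiricalChoice {D : ℕ} (u : Env D) (j : Indices D) (n : ℕ) :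
    ProbabilityMeasure unitInterval :=
  ⟨empirical (n + 1) fun i => u i (j i), inferInstance⟩

/-- The set of weak limit points of the empirical measures of the choices `u_i^{j_i}`. -/
def limitPts {D : ℕ} (u : Env D) (j : Indices D) : Set (ProbabilityMeasure unitInterval) :=
  {ν | ∃ φ : ℕ → ℕ, StrictMono φ ∧ Tendsto (fun k => empiricalChoice u j (φ k)) atTop (𝓝 ν)}

/-! ### Grid entropy -/

/-- The `k`-th smallest value (counted with multiplicity, `k ≥ 1`) of the finite family `f`;
it is `∞` if `k` exceeds the number of members of the family. -/
noncomputable def orderStat {ι : Type*} [Fintype ι] (k : ℕ) (f : ι → ℝ≥0∞) : ℝ≥0∞ :=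
  sInf {r | k ≤ Nat.card {i // f i ≤ r}}

/-- Grid entropy (at length parameter `1`): the supremum of all `α ≥ 0` such that, almost surely,
the `⌊e^{α n}⌋`-th smallest Lévy-Prokhorov distance between `ν` and the empirical measures of the
`D ^ n` paths of length `n` tends to `0`; it is `-∞` if there is no such `α`. -/
noncomputable def gridEntropy (D : ℕ) (ν : Measure unitInterval) : EReal :=
  sSup {a | ∃ α : ℝ, 0 ≤ α ∧ a = (α : EReal) ∧
    ∀ᵐ u ∂(envLaw D),
      Tendsto (fun n : ℕ => orderStat ⌊Real.exp (α * n)⌋₊ fun π : Fin n → Fin D =>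
        levyProkhorovEDist (empirical n fun i => u i (π i)) ν) atTop (𝓝 0)}

/-- The set `ℛ` of probability measures with finite grid entropy. -/
def finiteGridEntropy (D : ℕ) : Set (ProbabilityMeasure unitInterval) :=
  {ν | 0 ≤ gridEntropy D ν}

/-! ### Strategies -/

/-- A strategy: a joint law of the environment and of the sequence of chosen indices. -/
def IsStrategy {D : ℕ} (χ : Measure (Env D × Indices D)) : Prop :=
  IsProbabilityMeasure χ ∧ χ.map Prod.fst = envLaw D

/-- A single-edge strategy: a joint law of `D` i.i.d. uniform labels and of the chosen index. -/
def IsSingleEdgeStrategy {D : ℕ} (ψ : Measure (Labels D × Fin D)) : Prop :=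
  IsProbabilityMeasure ψ ∧ ψ.map Prod.fst = labelsLaw D

/-- The strategy `⨉ ψ_i` which makes its choice in trial `i` by `ψ_i`, independently. -/
noncomputable def productStrategy {D : ℕ} (ψ : ℕ → Measure (Labels D × Fin D)) :
    Measure (Env D × Indices D) :=
  (Measure.infinitePi ψ).map fun x => (fun i => (x i).1, fun i => (x i).2)

/-- All strategies. -/
def strategies (D : ℕ) : Set (Measure (Env D × Indices D)) :=
  {χ | IsStrategy χ}

/-- Independent strategies: infinite products of single-edge strategies. -/
def independentStrategies (D : ℕ) : Set (Measure (Env D × Indices D)) :=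
  {χ | ∃ ψ : ℕ → Measure (Labels D × Fin D),
    (∀ i, IsSingleEdgeStrategy (ψ i)) ∧ χ = productStrategy ψ}

/-- I.i.d. strategies: infinite powers of one single-edge strategy. -/
def iidStrategies (D : ℕ) : Set (Measure (Env D × Indices D)) :=
  {χ | ∃ ψ : Measure (Labels D × Fin D),
    IsSingleEdgeStrategy ψ ∧ χ = productStrategy fun _ => ψ}

/-- The laws `σ_ψ` of the single choice `U^J`, over all single-edge strategies `ψ`. -/
def singleEdgeLaws (D : ℕ) : Set (ProbabilityMeasure unitInterval) :=
  {ν | ∃ ψ : Measure (Labels D × Fin D), IsSingleEdgeStrategy ψ ∧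
    (ν : Measure unitInterval) = ψ.map fun x => x.1 x.2}

/-- The laws `σ_χ^0` of the first choice `U_0^{J_0}`, over all strategies `χ`. -/
def firstChoiceLaws (D : ℕ) : Set (ProbabilityMeasure unitInterval) :=
  {ν | ∃ χ : Measure (Env D × Indices D), IsStrategy χ ∧
    (ν : Measure unitInterval) = χ.map fun x => x.1 0 (x.2 0)}

/-! ### Limit points over a class of strategies -/

/-- The probability measures that are, for some strategy in the class `C`, almost surely a limit
point of its empirical measures. -/
def almostSureLimitPts {D : ℕ} (C : Set (Measure (Env D × Indices D))) :
    Set (ProbabilityMeasure unitInterval) :=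
  {ν | ∃ χ ∈ C, ∀ᵐ x ∂χ, ν ∈ limitPts x.1 x.2}

/-- Limit points over all strategies when the environment `u` is observed. A strategy is given here
by the conditional law of the indices given the environment, a Markov kernel `κ`. -/
def quenchedLimitPts {D : ℕ} (u : Env D) : Set (ProbabilityMeasure unitInterval) :=
  {ν | ∃ κ : Kernel (Env D) (Indices D), IsMarkovKernel κ ∧
    ∀ᵐ j ∂(κ u), ν ∈ limitPts u j}

/-- Limit points over all independent strategies when the environment `u` is observed. The `i`-th
single-edge strategy is given by its conditional probabilities, a Markov kernel `p i`. -/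
def quenchedLimitPtsIndependent {D : ℕ} (u : Env D) : Set (ProbabilityMeasure unitInterval) :=
  {ν | ∃ p : ℕ → Kernel (Labels D) (Fin D), (∀ i, IsMarkovKernel (p i)) ∧
    ∀ᵐ j ∂(Measure.infinitePi fun i => p i (u i)), ν ∈ limitPts u j}

/-- Limit points over all i.i.d. strategies when the environment `u` is observed. The single-edge
strategy is given by its conditional probabilities, a Markov kernel `p`. -/
def quenchedLimitPtsIid {D : ℕ} (u : Env D) : Set (ProbabilityMeasure unitInterval) :=
  {ν | ∃ p : Kernel (Labels D) (Fin D), IsMarkovKernel p ∧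
    ∀ᵐ j ∂(Measure.infinitePi fun i => p (u i)), ν ∈ limitPts u j}

/-! ### Weak convergence of empirical measures on a compact metrizable space -/

section EmpiricalMeasures

/-! Every set is compared with `singleEdgeLaws D`, the laws of a single choice.

Upper bound: by the strong law almost every environment is typical, meaning that its label vectors
equidistribute. Along any choice of indices the empirical measures of the pairs (label vector,
index) live in a compact space. A limit of them has first marginal `labelsLaw D`, so it is a
single-edge strategy, and the limit of the chosen labels is its image under the continuous
evaluation map (`IsTypicalEnv.mem_singleEdgeLaws`). The path may change with the length, so this
covers grid entropy as well as infinite paths.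

Lower bound: for a single law, i.i.d. copies and the strong law suffice (`ae_tendsto_of_iid`). To
reach all laws outside one null set, take countably many strategies with dense laws and play each on
infinitely many blocks so long that the past becomes negligible. Limit points form a closed set, so
this one independent strategy almost surely has every single-edge law as a limit point
(`exists_independent_limitPts`). By disintegration, almost every environment carries one index
sequence with all these limit points. Label vectors are almost surely distinct, so this sequence is
a function of the label vector alone, and hence is already produced by an i.i.d. kernel chosen after
seeing the environment. -/

/-- The empirical measure of the first `n + 1` terms of a sequence. -/
noncomputable def empiricalSeq {X : Type*} [MeasurableSpace X] (x : ℕ → X) (n : ℕ) :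
    ProbabilityMeasure X :=
  ⟨((n + 1 : ℕ) : ℝ≥0∞)⁻¹ • ∑ i : Fin (n + 1), Measure.dirac (x i), ⟨by
    simp only [Measure.smul_apply, Measure.finsetSum_apply, measure_univ,
      Finset.sum_const, Finset.card_univ, Fintype.card_fin, smul_eq_mul, nsmul_eq_mul, mul_one]
    exact ENNReal.inv_mul_cancel (by simp) (ENNReal.natCast_ne_top _)⟩⟩

theorem empiricalSeq_map {X Y : Type*} [MeasurableSpace X] [MeasurableSpace Y] {f : X → Y}
    (hf : Measurable f) (x : ℕ → X) (n : ℕ) :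
    (empiricalSeq x n).map hf.aemeasurable = empiricalSeq (fun i => f (x i)) n := by
  apply Subtype.ext
  simp only [empiricalSeq, ProbabilityMeasure.map, ProbabilityMeasure.coe_mk]
  rw [Measure.map_smul]
  congr 1
  rw [← Measure.mapₗ_apply_of_measurable hf, map_sum]
  simp [Measure.mapₗ_apply_of_measurable hf, Measure.map_dirac' hf]

theorem integral_empiricalSeq {X : Type*} [MeasurableSpace X] (x : ℕ → X) (n : ℕ) {f : X → ℝ}
    (hf : StronglyMeasurable f) :
    ∫ y, f y ∂(empiricalSeq x n : Measure X) =
      (∑ i ∈ Finset.range (n + 1), f (x i)) / ((n + 1 : ℕ) : ℝ) := by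
  simp only [empiricalSeq, ProbabilityMeasure.coe_mk]
  rw [integral_smul_measure, integral_finsetSum_measure]
  · simp only [integral_dirac' _ _ hf, smul_eq_mul]
    rw [Fin.sum_univ_eq_sum_range (fun i => f (x i)), ENNReal.toReal_inv, ENNReal.toReal_natCast,
      div_eq_inv_mul]
  · intro i _
    exact integrable_dirac' hf (by simp)

variable {X : Type*} [MeasurableSpace X] [TopologicalSpace X] [CompactSpace X]
  [BorelSpace X]

theorem tendsto_integral_continuousMap {ι : Type*} {l : Filter ι}
    {μs : ι → ProbabilityMeasure X} {μ : ProbabilityMeasure X} (h : Tendsto μs l (𝓝 μ))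
    (f : C(X, ℝ)) :
    Tendsto (fun i => ∫ y, f y ∂(μs i : Measure X)) l (𝓝 (∫ y, f y ∂(μ : Measure X))) :=
  ProbabilityMeasure.tendsto_iff_forall_integral_tendsto.1 h
    (BoundedContinuousFunction.mkOfCompact f)

variable [TopologicalSpace.MetrizableSpace X]

/-- Weak convergence on a compact space can be tested on a dense sequence of functions. -/
theorem tendsto_probabilityMeasure_of_dense {ι : Type*} {l : Filter ι}
    {F : ℕ → C(X, ℝ)} (hF : DenseRange F) {μs : ι → ProbabilityMeasure X}
    {μ : ProbabilityMeasure X}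
    (h : ∀ m, Tendsto (fun i => ∫ y, F m y ∂(μs i : Measure X)) l
      (𝓝 (∫ y, F m y ∂(μ : Measure X)))) :
    Tendsto μs l (𝓝 μ) := by
  rw [ProbabilityMeasure.tendsto_iff_forall_integral_tendsto]
  intro f
  -- Integration against a probability measure is 1-Lipschitz for the sup norm, uniformly in the
  -- measure; this allows an ε/3 argument.
  have key : ∀ (ν : ProbabilityMeasure X) (g g' : C(X, ℝ)),
      dist (∫ y, g y ∂(ν : Measure X)) (∫ y, g' y ∂(ν : Measure X)) ≤ dist g g' := by
    intro ν g g'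
    have hi : ∀ g : C(X, ℝ), Integrable g (ν : Measure X) := fun g =>
      g.continuous.integrable_of_hasCompactSupport (HasCompactSupport.of_compactSpace _)
    rw [dist_eq_norm, ← integral_sub (hi g) (hi g')]
    refine (norm_integral_le_of_norm_le_const (C := dist g g')
      (Eventually.of_forall fun y => ?_)).trans (by simp)
    rw [← dist_eq_norm]
    exact ContinuousMap.dist_apply_le_dist y
  rw [Metric.tendsto_nhds]
  intro ε hε
  obtain ⟨m, hm⟩ := hF.exists_dist_lt f.toContinuousMap (ε := ε / 3) (by positivity)
  filter_upwards [Metric.tendsto_nhds.1 (h m) (ε / 3) (by positivity)] with i hi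
  have h1 := key (μs i) f.toContinuousMap (F m)
  have h2 := key μ f.toContinuousMap (F m)
  change dist (∫ y, f.toContinuousMap y ∂(μs i : Measure X))
    (∫ y, f.toContinuousMap y ∂(μ : Measure X)) < ε
  rw [dist_comm] at h2
  linarith [dist_triangle4 (∫ y, f.toContinuousMap y ∂(μs i : Measure X))
    (∫ y, F m y ∂(μs i : Measure X)) (∫ y, F m y ∂(μ : Measure X))
    (∫ y, f.toContinuousMap y ∂(μ : Measure X))]

/-- Varadarajan's theorem: the empirical measures of an i.i.d. sequence converge weakly to its
law. -/
theorem ae_tendsto_empiricalSeq {Ω : Type*} [MeasurableSpace Ω] {P : Measure Ω}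
    [IsProbabilityMeasure P] {Y : ℕ → Ω → X} (hm : ∀ i, Measurable (Y i))
    (hY : iIndepFun Y P) (ν : ProbabilityMeasure X) (hν : ∀ i, P.map (Y i) = ν) :
    ∀ᵐ ω ∂P, Tendsto (fun n => empiricalSeq (fun i => Y i ω) n) atTop (𝓝 ν) := by
  have hF := TopologicalSpace.denseRange_denseSeq C(X, ℝ)
  set F := TopologicalSpace.denseSeq C(X, ℝ)
  have hFm : ∀ m, Measurable (F m) := fun m => (F m).continuous.measurable
  have : ∀ᵐ ω ∂P, ∀ m, Tendsto (fun n : ℕ => (∑ i ∈ Finset.range n, F m (Y i ω)) / (n : ℝ)) atTop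
      (𝓝 (∫ y, F m y ∂(ν : Measure X))) := by
    rw [ae_all_iff]
    intro m
    have hint : Integrable (fun ω => F m (Y 0 ω)) P := by
      refine Integrable.of_bound ((hFm m).comp (hm 0)).aestronglyMeasurable ‖F m‖
        (Eventually.of_forall fun ω => (F m).norm_coe_le_norm _)
    have := strong_law_ae_real (μ := P) (fun i ω => F m (Y i ω)) hint
      (fun i j hij => (hY.indepFun hij).comp (hFm m) (hFm m))
      (fun i => (IdentDistrib.mk (hm i).aemeasurable (hm 0).aemeasurable
        ((hν i).trans (hν 0).symm)).comp (hFm m))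
    rwa [show ∫ ω, F m (Y 0 ω) ∂P = ∫ y, F m y ∂(ν : Measure X) by
      rw [← hν 0, integral_map (hm 0).aemeasurable (hFm m).aestronglyMeasurable]] at this
  filter_upwards [this] with ω hω
  refine tendsto_probabilityMeasure_of_dense hF fun m => ?_
  simp_rw [integral_empiricalSeq _ _ (F m).continuous.stronglyMeasurable]
  exact (tendsto_add_atTop_iff_nat 1).2 (hω m)

/-- Countably many test functions decide convergence. Measurability is what lets almost sure
convergence be carried to a pushforward measure. -/
theorem measurableSet_tendsto_empiricalSeq {Ω : Type*} [MeasurableSpace Ω] {Y : ℕ → Ω → X}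
    (hm : ∀ i, Measurable (Y i)) (φ : ℕ → ℕ) (ν : ProbabilityMeasure X) :
    MeasurableSet {ω | Tendsto (fun n => empiricalSeq (fun i => Y i ω) (φ n)) atTop (𝓝 ν)} := by
  have hF := TopologicalSpace.denseRange_denseSeq C(X, ℝ)
  set F := TopologicalSpace.denseSeq C(X, ℝ)
  have : {ω | Tendsto (fun n => empiricalSeq (fun i => Y i ω) (φ n)) atTop (𝓝 ν)} =
      ⋂ m, {ω | Tendsto (fun n => ∫ y, F m y ∂(empiricalSeq (fun i => Y i ω) (φ n) : Measure X))
        atTop (𝓝 (∫ y, F m y ∂(ν : Measure X)))} := by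
    ext ω
    simp only [Set.mem_iInter]
    exact ⟨fun h m => tendsto_integral_continuousMap h (F m),
      fun h => tendsto_probabilityMeasure_of_dense hF h⟩
  rw [this]
  refine MeasurableSet.iInter fun m => measurableSet_tendsto _ fun n => ?_
  simp_rw [integral_empiricalSeq _ _ (F m).continuous.stronglyMeasurable]
  exact (Finset.measurable_sum _ fun i _ => (F m).continuous.measurable.comp (hm i)).div_const _

/-- Changing a negligible initial segment does not affect the limit of empirical measures. -/
theorem tendsto_empiricalSeq_of_eq_on {x y : ℕ → X} {a φ : ℕ → ℕ} {ν : ProbabilityMeasure X}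
    (hxy : ∀ l i, a l ≤ i → i ≤ φ l → x i = y i)
    (ha : Tendsto (fun l => (a l : ℝ) / ((φ l + 1 : ℕ) : ℝ)) atTop (𝓝 0))
    (hy : Tendsto (fun l => empiricalSeq y (φ l)) atTop (𝓝 ν)) :
    Tendsto (fun l => empiricalSeq x (φ l)) atTop (𝓝 ν) := by
  refine tendsto_probabilityMeasure_of_dense (TopologicalSpace.denseRange_denseSeq C(X, ℝ))
    fun m => ?_
  set f := TopologicalSpace.denseSeq C(X, ℝ) m
  have hb : Tendsto (fun l => ∫ z, f z ∂(empiricalSeq x (φ l) : Measure X) -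
      ∫ z, f z ∂(empiricalSeq y (φ l) : Measure X)) atTop (𝓝 0) := by
    -- Fewer than `a l + 1` terms differ, each by at most `2 * ‖f‖`.
    refine squeeze_zero_norm (a := fun l => 2 * ‖f‖ * ((a l : ℝ) / ((φ l + 1 : ℕ) : ℝ)))
      (fun l => ?_) (by simpa using ha.const_mul (2 * ‖f‖))
    simp_rw [integral_empiricalSeq _ _ f.continuous.stronglyMeasurable]
    rw [← sub_div, ← Finset.sum_sub_distrib, norm_div, ← mul_div_assoc, Real.norm_natCast]
    gcongr
    calc ‖∑ i ∈ Finset.range (φ l + 1), (f (x i) - f (y i))‖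
        = ‖∑ i ∈ (Finset.range (φ l + 1)).filter (· < a l), (f (x i) - f (y i))‖ := by
          rw [Finset.sum_filter_of_ne]
          intro i hi hne
          by_contra hlt
          exact hne (by rw [hxy l i (not_lt.1 hlt) (Nat.lt_succ_iff.1 (Finset.mem_range.1 hi)),
            sub_self])
      _ ≤ ((Finset.range (φ l + 1)).filter (· < a l)).card * (2 * ‖f‖) := by
          rw [← nsmul_eq_mul]
          refine (norm_sum_le _ _).trans (Finset.sum_le_card_nsmul _ _ _ fun i _ => ?_)
          linarith [norm_sub_le (f (x i)) (f (y i)), f.norm_coe_le_norm (x i),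
            f.norm_coe_le_norm (y i)]
      _ ≤ a l * (2 * ‖f‖) := by
          gcongr
          calc _ ≤ (Finset.range (a l)).card := Finset.card_le_card fun i hi => by
                simpa using (Finset.mem_filter.1 hi).2
            _ = a l := Finset.card_range _
      _ = 2 * ‖f‖ * a l := by ring
  simpa using hb.add (tendsto_integral_continuousMap hy f)

end EmpiricalMeasures

/-! ### Strategies, typical environments and the laws of single choices -/

section Strategies

variable {D : ℕ}

theorem continuous_choice : Continuous fun x : Labels D × Fin D => x.1 x.2 :=
  continuous_prod_of_discrete_right.2 fun j => continuous_apply j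

theorem measurable_choice : Measurable fun x : Labels D × Fin D => x.1 x.2 :=
  continuous_choice.measurable

theorem measurable_splitPairs :
    Measurable fun x : ℕ → Labels D × Fin D =>
      ((fun i => (x i).1, fun i => (x i).2) : Env D × Indices D) :=
  (measurable_pi_lambda _ fun i => (measurable_pi_apply i).fst).prodMk
    (measurable_pi_lambda _ fun i => (measurable_pi_apply i).snd)

theorem isStrategy_productStrategy {ψ : ℕ → Measure (Labels D × Fin D)}
    (hψ : ∀ i, IsSingleEdgeStrategy (ψ i)) : IsStrategy (productStrategy ψ) := by
  have := fun i => (hψ i).1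
  refine ⟨Measure.isProbabilityMeasure_map measurable_splitPairs.aemeasurable, ?_⟩
  rw [productStrategy, Measure.map_map measurable_fst measurable_splitPairs]
  change Measure.map (fun (x : ℕ → Labels D × Fin D) i => (x i).1) _ = _
  rw [Measure.infinitePi_map_pi (f := fun _ => Prod.fst) ψ fun _ => measurable_fst]
  simp only [fun i => (hψ i).2, envLaw]

theorem independentStrategies_subset : independentStrategies D ⊆ strategies D := by
  rintro _ ⟨ψ, hψ, rfl⟩
  exact isStrategy_productStrategy hψ

theorem iidStrategies_subset : iidStrategies D ⊆ independentStrategies D := by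
  rintro _ ⟨ψ, hψ, rfl⟩
  exact ⟨fun _ => ψ, fun _ => hψ, rfl⟩

/-- The marginal of a strategy in trial 0 is a single-edge strategy; conversely, take the infinite
power of a single-edge strategy. -/
theorem firstChoiceLaws_eq_singleEdgeLaws : firstChoiceLaws D = singleEdgeLaws D := by
  ext ν
  have hmeas : Measurable fun x : Env D × Indices D => (x.1 0, x.2 0) := by fun_prop
  constructor
  · rintro ⟨χ, ⟨hp, hχ⟩, hν⟩
    refine ⟨χ.map fun x => (x.1 0, x.2 0),
      ⟨Measure.isProbabilityMeasure_map hmeas.aemeasurable, ?_⟩, ?_⟩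
    · rw [Measure.map_map measurable_fst hmeas]
      change χ.map ((fun u : Env D => u 0) ∘ Prod.fst) = _
      rw [← Measure.map_map (measurable_pi_apply 0) measurable_fst, hχ, envLaw,
        Measure.infinitePi_map_eval]
    · rw [hν, Measure.map_map measurable_choice hmeas]
      rfl
  · rintro ⟨ψ, hψ, hν⟩
    have := hψ.1
    refine ⟨productStrategy fun _ => ψ, isStrategy_productStrategy fun _ => hψ, ?_⟩
    have hmeas' : Measurable fun x : Env D × Indices D => x.1 0 (x.2 0) :=
      measurable_choice.comp hmeas
    rw [productStrategy, Measure.map_map hmeas' measurable_splitPairs, hν]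
    change _ = Measure.map ((fun x : Labels D × Fin D => x.1 x.2) ∘
      fun x : ℕ → Labels D × Fin D => x 0) _
    rw [← Measure.map_map measurable_choice (measurable_pi_apply 0), Measure.infinitePi_map_eval]

theorem singleEdgeLaws_nonempty (hD : 1 ≤ D) : (singleEdgeLaws D).Nonempty := by
  let ψ : Measure (Labels D × Fin D) := (labelsLaw D).prod (Measure.dirac ⟨0, hD⟩)
  refine ⟨⟨ψ.map fun x => x.1 x.2,
    Measure.isProbabilityMeasure_map measurable_choice.aemeasurable⟩, ψ, ⟨inferInstance, ?_⟩, rfl⟩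
  exact (Measure.map_fst_prod).trans (by simp)

theorem isSingleEdgeStrategy_iff (θ : ProbabilityMeasure (Labels D × Fin D)) :
    IsSingleEdgeStrategy (θ : Measure (Labels D × Fin D)) ↔
      θ.map continuous_fst.aemeasurable = (⟨labelsLaw D, inferInstance⟩ : ProbabilityMeasure _) :=
  ⟨fun h => Subtype.ext h.2, fun h => ⟨inferInstance, congrArg Subtype.val h⟩⟩

theorem mem_singleEdgeLaws_iff {ν : ProbabilityMeasure unitInterval} :
    ν ∈ singleEdgeLaws D ↔ ∃ θ : ProbabilityMeasure (Labels D × Fin D),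
      θ.map continuous_fst.aemeasurable = (⟨labelsLaw D, inferInstance⟩ : ProbabilityMeasure _) ∧
      θ.map continuous_choice.aemeasurable = ν := by
  constructor
  · rintro ⟨ψ, hψ, hν⟩
    exact ⟨⟨ψ, hψ.1⟩, Subtype.ext hψ.2, Subtype.ext hν.symm⟩
  · rintro ⟨θ, h1, h2⟩
    exact ⟨θ, (isSingleEdgeStrategy_iff θ).2 h1, congrArg Subtype.val h2.symm⟩

/-- Single-edge strategies are the measures on a compact space with a prescribed marginal, hence a
compact set, and the law of the choice depends on them continuously. -/
theorem isClosed_singleEdgeLaws : IsClosed (singleEdgeLaws D) := by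
  have : singleEdgeLaws D =
      (fun θ : ProbabilityMeasure (Labels D × Fin D) => θ.map continuous_choice.aemeasurable) ''
        {θ | θ.map continuous_fst.aemeasurable =
          (⟨labelsLaw D, inferInstance⟩ : ProbabilityMeasure _)} := by
    ext ν
    exact mem_singleEdgeLaws_iff
  rw [this]
  refine (IsCompact.image (IsClosed.isCompact ?_)
    (ProbabilityMeasure.continuous_map continuous_choice)).isClosed
  exact isClosed_eq (ProbabilityMeasure.continuous_map continuous_fst) continuous_const

/-- An environment whose label vectors are equidistributed. -/
def IsTypicalEnv (u : Env D) : Prop :=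
  Tendsto (fun n => empiricalSeq u n) atTop (𝓝 ⟨labelsLaw D, inferInstance⟩)

theorem ae_isTypicalEnv : ∀ᵐ u ∂(envLaw D), IsTypicalEnv u :=
  ae_tendsto_empiricalSeq (P := envLaw D) (Y := fun i u => u i) (fun i => measurable_pi_apply i)
    (iIndepFun_infinitePi (X := fun _ x => x) fun _ => measurable_id)
    ⟨labelsLaw D, inferInstance⟩ fun i => Measure.infinitePi_map_eval _ i

/-- Compactness is applied to the empirical measures of the pairs, which remember the index; both
marginal conditions survive the limit because projection and choice are continuous. `J` depends on
`k` because near-optimal paths for grid entropy need not extend one another. -/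
theorem IsTypicalEnv.mem_singleEdgeLaws {u : Env D} (hu : IsTypicalEnv u) {J : ℕ → Indices D}
    {φ : ℕ → ℕ} (hφ : Tendsto φ atTop atTop) {ν : ProbabilityMeasure unitInterval}
    (hν : Tendsto (fun k => empiricalChoice u (J k) (φ k)) atTop (𝓝 ν)) :
    ν ∈ singleEdgeLaws D := by
  obtain ⟨θ, ψ, hψ, hθ⟩ := CompactSpace.tendsto_subseq
    fun k => empiricalSeq (fun i => (u i, J k i)) (φ k)
  refine mem_singleEdgeLaws_iff.2 ⟨θ, ?_, ?_⟩
  · refine tendsto_nhds_unique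
      (ProbabilityMeasure.tendsto_map_of_tendsto_of_continuous _ _ hθ continuous_fst) ?_
    simp only [Function.comp_apply, empiricalSeq_map measurable_fst]
    exact Tendsto.comp hu (hφ.comp hψ.tendsto_atTop)
  · refine tendsto_nhds_unique
      (ProbabilityMeasure.tendsto_map_of_tendsto_of_continuous _ _ hθ continuous_choice) ?_
    simp only [Function.comp_apply, empiricalSeq_map measurable_choice]
    exact hν.comp hψ.tendsto_atTop

theorem IsTypicalEnv.limitPts_subset {u : Env D} (hu : IsTypicalEnv u) (j : Indices D) :
    limitPts u j ⊆ singleEdgeLaws D := by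
  rintro ν ⟨φ, hφ, h⟩
  exact hu.mem_singleEdgeLaws (J := fun _ => j) hφ.tendsto_atTop h

theorem isClosed_limitPts (u : Env D) (j : Indices D) : IsClosed (limitPts u j) := by
  have : limitPts u j = {ν | MapClusterPt ν atTop (empiricalChoice u j)} := by
    ext ν
    constructor
    · rintro ⟨φ, hφ, h⟩
      exact MapClusterPt.of_comp hφ.tendsto_atTop h.mapClusterPt
    · intro h
      exact h.tendsto_subseq
  rw [this]
  exact isClosed_setOfPred_clusterPt

theorem measurableSet_tendsto_empiricalChoice (φ : ℕ → ℕ) (ν : ProbabilityMeasure unitInterval) :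
    MeasurableSet {x : Env D × Indices D |
      Tendsto (fun n => empiricalChoice x.1 x.2 (φ n)) atTop (𝓝 ν)} :=
  measurableSet_tendsto_empiricalSeq (Y := fun i (x : Env D × Indices D) => x.1 i (x.2 i))
    (fun i => measurable_choice.comp (by fun_prop : Measurable fun x : Env D × Indices D =>
      (x.1 i, x.2 i))) φ ν

/-- Convergence under a product strategy depends only on the law of the pairs, so it may be proved
on any space `Ω` that carries a convenient coupling. -/
theorem ae_productStrategy_tendsto {ψ : ℕ → Measure (Labels D × Fin D)}
    {Ω : Type*} [MeasurableSpace Ω] {P : Measure Ω} {w : Ω → ℕ → Labels D × Fin D}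
    (hw : Measurable w) (hlaw : P.map w = Measure.infinitePi ψ) (φ : ℕ → ℕ)
    {ν : ProbabilityMeasure unitInterval}
    (h : ∀ᵐ ω ∂P, Tendsto (fun n => empiricalSeq (fun i => (w ω i).1 (w ω i).2) (φ n)) atTop
      (𝓝 ν)) :
    ∀ᵐ x ∂(productStrategy ψ), Tendsto (fun n => empiricalChoice x.1 x.2 (φ n)) atTop (𝓝 ν) := by
  rw [productStrategy, ← hlaw, Measure.map_map measurable_splitPairs hw,
    ae_map_iff (measurable_splitPairs.comp hw).aemeasurable
      (measurableSet_tendsto_empiricalChoice φ ν)]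
  exact h

/-- The empirical measures of the choices by i.i.d. copies of a single-edge strategy converge
almost surely to the law of a single choice. -/
theorem ae_tendsto_empiricalSeq_choice {Ω : Type*} [MeasurableSpace Ω] {P : Measure Ω}
    [IsProbabilityMeasure P] {Z : ℕ → Ω → Labels D × Fin D} (hm : ∀ i, Measurable (Z i))
    (hZ : iIndepFun Z P) {ψ : Measure (Labels D × Fin D)} (hlaw : ∀ i, P.map (Z i) = ψ)
    {ν : ProbabilityMeasure unitInterval}
    (hν : (ν : Measure unitInterval) = ψ.map fun x => x.1 x.2) :
    ∀ᵐ ω ∂P, Tendsto (fun n => empiricalSeq (fun i => (Z i ω).1 (Z i ω).2) n) atTop (𝓝 ν) := by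
  refine ae_tendsto_empiricalSeq (Y := fun i ω => (Z i ω).1 (Z i ω).2)
    (fun i => measurable_choice.comp (hm i)) (hZ.comp (fun _ x => x.1 x.2)
      fun _ => measurable_choice) ν fun i => ?_
  rw [hν, ← hlaw i, Measure.map_map measurable_choice (hm i)]
  rfl

/-- The empirical measures of an i.i.d. strategy converge almost surely to the law of a single
choice. -/
theorem ae_tendsto_of_iid {ψ : Measure (Labels D × Fin D)} (hψ : IsSingleEdgeStrategy ψ)
    {ν : ProbabilityMeasure unitInterval}
    (hν : (ν : Measure unitInterval) = ψ.map fun x => x.1 x.2) :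
    ∀ᵐ x ∂(productStrategy fun _ => ψ), Tendsto (empiricalChoice x.1 x.2) atTop (𝓝 ν) := by
  have := hψ.1
  have h := ae_tendsto_empiricalSeq_choice (P := Measure.infinitePi fun _ : ℕ => ψ)
    (Z := fun i (x : ℕ → Labels D × Fin D) => x i) (fun i => measurable_pi_apply i)
    (iIndepFun_infinitePi (X := fun _ x => x) fun _ => measurable_id)
    (fun i => Measure.infinitePi_map_eval _ i) hν
  exact ae_productStrategy_tendsto (P := Measure.infinitePi fun _ : ℕ => ψ) (w := fun x => x)
    measurable_id Measure.map_id (fun n => n) h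

/-! ### Block strategies and simultaneous limit points -/

/-- The index of the double-exponential block `[2 ^ 2 ^ m, 2 ^ 2 ^ (m + 1))` that contains `i`. -/
def blockIndex (i : ℕ) : ℕ := Nat.log 2 (Nat.log 2 i)

theorem blockIndex_eq {m i : ℕ} (h1 : 2 ^ 2 ^ m ≤ i) (h2 : i < 2 ^ 2 ^ (m + 1)) :
    blockIndex i = m := by
  have hi : i ≠ 0 := (lt_of_lt_of_le (by positivity) h1).ne'
  have h3 : 2 ^ m ≤ Nat.log 2 i := (Nat.le_log_iff_pow_le one_lt_two hi).2 h1
  have h4 : Nat.log 2 i < 2 ^ (m + 1) := Nat.log_lt_of_lt_pow hi h2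
  exact Nat.log_eq_of_pow_le_of_lt_pow h3 h4

/-- A block that starts at N = `2 ^ 2 ^ m` ends just before N², so everything before it has weight
1/N. The `- 1 + 1` appears because the empirical measure with last index `φ` has `φ + 1` terms. -/
theorem tendsto_block_ratio {m : ℕ → ℕ} (hm : Tendsto m atTop atTop) :
    Tendsto (fun l => ((2 ^ 2 ^ m l : ℕ) : ℝ) / ((2 ^ 2 ^ (m l + 1) - 1 + 1 : ℕ) : ℝ)) atTop
      (𝓝 0) := by
  have h : ∀ k : ℕ, ((2 ^ 2 ^ k : ℕ) : ℝ) / ((2 ^ 2 ^ (k + 1) - 1 + 1 : ℕ) : ℝ) =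
      (1 / 2 : ℝ) ^ 2 ^ k := by
    intro k
    rw [Nat.sub_add_cancel Nat.one_le_two_pow, pow_succ 2 k, mul_two, pow_add]
    push_cast
    rw [one_div, inv_pow]
    field_simp
  simp_rw [h]
  exact (tendsto_pow_atTop_nhds_zero_of_lt_one (by norm_num) (by norm_num)).comp
    ((tendsto_pow_atTop_atTop_of_one_lt one_lt_two).comp hm)

/-- Block number `Nat.pair k l` is the `l`-th one given to strategy `k`; the ends of these blocks
are the times at which its law shows up. -/
theorem strictMono_blockEnd (k : ℕ) :
    StrictMono fun l => 2 ^ 2 ^ (Nat.pair k l + 1) - 1 := by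
  refine strictMono_nat_of_lt_succ fun l => ?_
  have h1 : Nat.pair k l < Nat.pair k (l + 1) := Nat.pair_lt_pair_right k (Nat.lt_succ_self l)
  have h2 : 2 ^ 2 ^ (Nat.pair k l + 1) < 2 ^ 2 ^ (Nat.pair k (l + 1) + 1) :=
    Nat.pow_lt_pow_right one_lt_two (Nat.pow_lt_pow_right one_lt_two (by omega))
  have := Nat.one_le_two_pow (n := 2 ^ (Nat.pair k l + 1))
  omega

/-- If single-edge strategies are chosen from a sequence according to `c`, then an index `k` that is
chosen on long blocks produces the limit point `ν k`. -/
theorem ae_tendsto_of_blocks {ψ : ℕ → Measure (Labels D × Fin D)}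
    (hψ : ∀ k, IsSingleEdgeStrategy (ψ k)) {c : ℕ → ℕ} {k : ℕ} {a φ : ℕ → ℕ}
    (hc : ∀ l i, a l ≤ i → i ≤ φ l → c i = k)
    (ha : Tendsto (fun l => (a l : ℝ) / ((φ l + 1 : ℕ) : ℝ)) atTop (𝓝 0))
    (hφ : Tendsto φ atTop atTop) {ν : ProbabilityMeasure unitInterval}
    (hν : (ν : Measure unitInterval) = (ψ k).map fun x => x.1 x.2) :
    ∀ᵐ x ∂(productStrategy fun i => ψ (c i)),
      Tendsto (fun l => empiricalChoice x.1 x.2 (φ l)) atTop (𝓝 ν) := by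
  -- Coupling: each trial independently draws from `Q` a whole sequence with one sample per
  -- strategy, and trial `i` plays coordinate `c i`. For fixed `k` the `k`-th coordinates are
  -- i.i.d., so the strong law applies to them, and the played sequence agrees with them on the long
  -- blocks.
  have := fun k => (hψ k).1
  have hQ : IsProbabilityMeasure (Measure.infinitePi ψ) := inferInstance
  generalize hQψ : Measure.infinitePi ψ = Q at hQ
  have hQk : ∀ k, Q.map (fun y => y k) = ψ k := fun k => by
    rw [← hQψ, Measure.infinitePi_map_eval]
  have hsel : Measurable fun (w : ℕ → ℕ → Labels D × Fin D) i => w i (c i) := by fun_prop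
  have hlaw : (Measure.infinitePi fun _ : ℕ => Q).map (fun w i => w i (c i)) =
      Measure.infinitePi fun i => ψ (c i) := by
    rw [Measure.infinitePi_map_pi (f := fun i y => y (c i)) (fun _ : ℕ => Q)
      fun i => measurable_pi_apply (c i)]
    simp only [hQk]
  have hlaw_k : ∀ i, (Measure.infinitePi fun _ : ℕ => Q).map (fun w => w i k) = ψ k := by
    intro i
    have h := Measure.map_map (μ := Measure.infinitePi fun _ : ℕ => Q)
      (measurable_pi_apply (X := fun _ : ℕ => Labels D × Fin D) k)
      (measurable_pi_apply (X := fun _ : ℕ => ℕ → Labels D × Fin D) i)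
    rw [Measure.infinitePi_map_eval, hQk] at h
    exact h.symm
  have hiid := ae_tendsto_empiricalSeq_choice (P := Measure.infinitePi fun _ : ℕ => Q)
    (Z := fun i (w : ℕ → ℕ → Labels D × Fin D) => w i k) (fun i => by fun_prop)
    (iIndepFun_infinitePi (P := fun _ : ℕ => Q) (X := fun _ y => y k)
      fun _ => measurable_pi_apply k) hlaw_k hν
  refine ae_productStrategy_tendsto hsel hlaw φ ?_
  filter_upwards [hiid] with w hw
  have hxy : ∀ l i, a l ≤ i → i ≤ φ l → (w i (c i)).1 (w i (c i)).2 = (w i k).1 (w i k).2 := by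
    intro l i h1 h2
    rw [hc l i h1 h2]
  exact tendsto_empiricalSeq_of_eq_on hxy ha (hw.comp hφ)

/-- Countably many single-edge strategies, each used in infinitely many dominating blocks, give
one independent strategy that almost surely has all their laws as limit points. -/
theorem ae_mem_limitPts_of_blocks {ψ : ℕ → Measure (Labels D × Fin D)}
    (hψ : ∀ k, IsSingleEdgeStrategy (ψ k)) {ν : ℕ → ProbabilityMeasure unitInterval}
    (hν : ∀ k, (ν k : Measure unitInterval) = (ψ k).map fun x => x.1 x.2) :
    ∀ᵐ x ∂(productStrategy fun i => ψ (Nat.unpair (blockIndex i)).1),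
      ∀ k, ν k ∈ limitPts x.1 x.2 := by
  rw [ae_all_iff]
  intro k
  have hmono := strictMono_blockEnd k
  refine (ae_tendsto_of_blocks hψ (a := fun l => 2 ^ 2 ^ Nat.pair k l)
    (φ := fun l => 2 ^ 2 ^ (Nat.pair k l + 1) - 1) ?_
    (tendsto_block_ratio (tendsto_atTop_mono (fun l => Nat.right_le_pair k l) tendsto_id))
    hmono.tendsto_atTop (hν k)).mono fun x hx => ⟨_, hmono, hx⟩
  intro l i h1 h2
  have h3 : blockIndex i = Nat.pair k l := by
    refine blockIndex_eq h1 ?_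
    have := Nat.one_le_two_pow (n := 2 ^ (Nat.pair k l + 1))
    omega
  rw [h3, Nat.unpair_pair]

instance : TopologicalSpace.SeparableSpace (ProbabilityMeasure unitInterval) := by
  let := TopologicalSpace.metrizableSpaceMetric (ProbabilityMeasure unitInterval)
  infer_instance

theorem exists_dense_singleEdgeLaws (hD : 1 ≤ D) :
    ∃ (ψ : ℕ → Measure (Labels D × Fin D)) (ν : ℕ → ProbabilityMeasure unitInterval),
      (∀ k, IsSingleEdgeStrategy (ψ k)) ∧
      (∀ k, (ν k : Measure unitInterval) = (ψ k).map fun x => x.1 x.2) ∧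
      singleEdgeLaws D ⊆ closure (Set.range ν) := by
  obtain ⟨c, hcS, hc, hdense⟩ :=
    (TopologicalSpace.IsSeparable.of_separableSpace (singleEdgeLaws D)).exists_countable_dense_subset
  have hne : c.Nonempty := by
    obtain ⟨ν, hν⟩ := singleEdgeLaws_nonempty hD
    exact closure_nonempty_iff.1 ⟨ν, hdense hν⟩
  obtain ⟨ν, rfl⟩ := hc.exists_eq_range hne
  choose ψ h1 h2 using fun k => hcS ⟨k, rfl⟩
  exact ⟨ψ, ν, h1, h2, hdense⟩

/-- The block strategy handles a dense sequence of laws outside one null set; closedness of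
`limitPts` then adds all remaining laws. -/
theorem exists_independent_limitPts (hD : 1 ≤ D) :
    ∃ χ ∈ independentStrategies D, ∀ᵐ x ∂χ, singleEdgeLaws D ⊆ limitPts x.1 x.2 := by
  obtain ⟨ψ, ν, h1, h2, h3⟩ := exists_dense_singleEdgeLaws hD
  refine ⟨_, ⟨_, fun i => h1 _, rfl⟩, (ae_mem_limitPts_of_blocks h1 h2).mono fun x hx => ?_⟩
  exact h3.trans (closure_minimal (Set.range_subset_iff.2 hx) (isClosed_limitPts _ _))

/-- Disintegrate `χ` over the environment: a property that holds almost surely for a conditional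
probability law holds for some index sequence. -/
theorem IsStrategy.ae_exists (hD : 1 ≤ D) {χ : Measure (Env D × Indices D)} (hχ : IsStrategy χ)
    {p : Env D × Indices D → Prop} (h : ∀ᵐ x ∂χ, p x) :
    ∀ᵐ u ∂(envLaw D), ∃ j, p (u, j) := by
  have := hχ.1
  have : Nonempty (Fin D) := ⟨⟨0, hD⟩⟩
  rw [← Measure.disintegrate χ χ.condKernel] at h
  have h' := Measure.ae_ae_of_ae_compProd h
  rw [Measure.fst, hχ.2] at h'
  exact h'.mono fun u hu => hu.exists

theorem ae_exists_limitPts (hD : 1 ≤ D) :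
    ∀ᵐ u ∂(envLaw D), ∃ j, singleEdgeLaws D ⊆ limitPts u j := by
  obtain ⟨χ, hχ, h⟩ := exists_independent_limitPts hD
  exact (independentStrategies_subset hχ).ae_exists hD h

end Strategies

/-! ### Finite grid entropy -/

section GridEntropy

variable {D : ℕ}

theorem tendsto_levyProkhorovEDist_iff {ι : Type*} {l : Filter ι}
    {μs : ι → ProbabilityMeasure unitInterval} {ν : ProbabilityMeasure unitInterval} :
    Tendsto (fun i => levyProkhorovEDist (μs i : Measure unitInterval) ν) l (𝓝 0) ↔
      Tendsto μs l (𝓝 ν) := by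
  rw [(LevyProkhorov.probabilityMeasureHomeomorph (Ω := unitInterval)).isInducing.tendsto_nhds_iff,
    tendsto_iff_edist_tendsto_0]
  rfl

theorem orderStat_one_le {ι : Type*} [Fintype ι] (f : ι → ℝ≥0∞) (i : ι) :
    orderStat 1 f ≤ f i := by
  refine sInf_le ?_
  have : Nonempty {j // f j ≤ f i} := ⟨⟨i, le_rfl⟩⟩
  exact Nat.card_pos

theorem exists_lt_of_orderStat_lt {ι : Type*} [Fintype ι] {k : ℕ} (hk : 1 ≤ k) {f : ι → ℝ≥0∞}
    {ε : ℝ≥0∞} (h : orderStat k f < ε) : ∃ i, f i < ε := by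
  obtain ⟨r, hr, hrε⟩ := sInf_lt_iff.1 h
  have : 0 < Nat.card {i // f i ≤ r} := hk.trans hr
  obtain ⟨i, hi⟩ := (Nat.card_pos_iff.1 this).1
  exact ⟨i, hi.trans_lt hrε⟩

/-- For `α ≥ 0` the rank `⌊e^{α n}⌋` is at least 1, so in a typical environment some path of each
large length is close to `ν`. -/
theorem finiteGridEntropy_subset (hD : 1 ≤ D) : finiteGridEntropy D ⊆ singleEdgeLaws D := by
  intro ν hν
  obtain ⟨_, ⟨α, hα, -, h⟩⟩ : Set.Nonempty {a | ∃ α : ℝ, 0 ≤ α ∧ a = (α : EReal) ∧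
      ∀ᵐ u ∂(envLaw D),
        Tendsto (fun n : ℕ => orderStat ⌊Real.exp (α * n)⌋₊ fun π : Fin n → Fin D =>
          levyProkhorovEDist (empirical n fun i => u i (π i)) ν) atTop (𝓝 0)} := by
    -- The supremum of the empty set in `EReal` is `⊥`, which is excluded by `0 ≤ gridEntropy D ν`.
    rw [Set.nonempty_iff_ne_empty]
    intro he
    have h0 : 0 ≤ gridEntropy D ν := hν
    rw [gridEntropy, he, sSup_empty] at h0
    exact absurd h0 (by simp)
  obtain ⟨u, hu, htyp⟩ := (h.and ae_isTypicalEnv).exists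
  have hev : ∀ m : ℕ, ∃ N, ∀ n ≥ N, ∃ j : Indices D,
      levyProkhorovEDist (empiricalChoice u j n : Measure unitInterval) ν <
        ((m : ℝ≥0∞) + 1)⁻¹ := by
    intro m
    have hlt := ((tendsto_add_atTop_iff_nat 1).2 hu).eventually_lt_const
      (u := ((m : ℝ≥0∞) + 1)⁻¹) (by simp)
    obtain ⟨N, hN⟩ := eventually_atTop.1 hlt
    refine ⟨N, fun n hn => ?_⟩
    obtain ⟨π, hπ⟩ := exists_lt_of_orderStat_lt (Nat.le_floor (by
      rw [Nat.cast_one]; exact Real.one_le_exp (by positivity))) (hN n hn)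
    -- The indices beyond the finite path are irrelevant; edge 0 is a filler.
    refine ⟨fun i => if h : i < n + 1 then π ⟨i, h⟩ else ⟨0, hD⟩, ?_⟩
    have hext : (fun i : Fin (n + 1) => u i (if h : (i : ℕ) < n + 1 then π ⟨i, h⟩ else ⟨0, hD⟩)) =
        fun i : Fin (n + 1) => u i (π i) := by
      funext i
      rw [dif_pos i.2]
    simpa only [empiricalChoice, ProbabilityMeasure.coe_mk, hext] using hπ
  obtain ⟨φ, hφ, hJ⟩ := extraction_forall_of_eventually' hev
  choose J hJ using hJ
  refine htyp.mem_singleEdgeLaws hφ.tendsto_atTop (J := J) (tendsto_levyProkhorovEDist_iff.1 ?_)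
  refine tendsto_of_tendsto_of_tendsto_of_le_of_le tendsto_const_nhds ?_ (fun _ => zero_le)
    fun k => (hJ k).le
  have := (tendsto_add_atTop_iff_nat 1).2 ENNReal.tendsto_inv_nat_nhds_zero
  simpa using this

/-- The value `α = 0` is admissible: the rank is then 1, and the smallest distance is bounded by the
one along a single index sequence whose empirical measures converge to `ν`. -/
theorem singleEdgeLaws_subset_finiteGridEntropy (hD : 1 ≤ D) :
    singleEdgeLaws D ⊆ finiteGridEntropy D := by
  rintro ν ⟨ψ, hψ, hν⟩
  refine le_sSup (show (0 : EReal) ∈ {a | ∃ α : ℝ, 0 ≤ α ∧ a = (α : EReal) ∧ _} from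
    ⟨0, le_rfl, rfl, ?_⟩)
  filter_upwards [(isStrategy_productStrategy fun _ => hψ).ae_exists hD
    (ae_tendsto_of_iid hψ hν)] with u ⟨j, hj⟩
  refine (tendsto_add_atTop_iff_nat 1).1 ?_
  refine tendsto_of_tendsto_of_tendsto_of_le_of_le tendsto_const_nhds
    (tendsto_levyProkhorovEDist_iff.2 hj) (fun _ => zero_le) fun n => ?_
  simp only [zero_mul, Real.exp_zero, Nat.floor_one]
  exact orderStat_one_le (fun π : Fin (n + 1) → Fin D =>
    levyProkhorovEDist (empirical (n + 1) fun i => u i (π i)) (ν : Measure unitInterval))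
    fun i => j i

theorem finiteGridEntropy_eq_singleEdgeLaws (hD : 1 ≤ D) :
    finiteGridEntropy D = singleEdgeLaws D :=
  (finiteGridEntropy_subset hD).antisymm (singleEdgeLaws_subset_finiteGridEntropy hD)

end GridEntropy

/-! ### Limit points of strategies in the three senses -/

section LimitPoints

variable {D : ℕ}

/-- The law of a label vector has no atoms once there is at least one edge, so independent copies
coincide with probability 0. This makes the trial recoverable from its labels. -/
theorem ae_injective_env (hD : 1 ≤ D) : ∀ᵐ u ∂(envLaw D), Function.Injective u := by
  have hna : NullSingletonClass (labelsLaw D) :=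
    Measure.pi_nullSingletonClass (μ := fun _ : Fin D => (volume : Measure unitInterval)) ⟨0, hD⟩
  have hpair : ∀ i k : ℕ, i ≠ k → ∀ᵐ u ∂(envLaw D), u i ≠ u k := by
    intro i k hik
    have hind : IndepFun (fun u : Env D => u i) (fun u => u k) (envLaw D) :=
      (iIndepFun_infinitePi (P := fun _ : ℕ => labelsLaw D) (X := fun _ x => x)
        fun _ => measurable_id).indepFun hik
    have hmap := (indepFun_iff_map_prod_eq_prod_map_map (measurable_pi_apply i).aemeasurable
      (measurable_pi_apply k).aemeasurable).1 hind
    have hlaw : ∀ i : ℕ, (envLaw D).map (fun u => u i) = labelsLaw D := fun i =>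
      Measure.infinitePi_map_eval _ i
    rw [hlaw i, hlaw k] at hmap
    have hdiag : ∀ᵐ x ∂((labelsLaw D).prod (labelsLaw D)), x.1 ≠ x.2 := by
      have hms : MeasurableSet {x : Labels D × Labels D | x.1 ≠ x.2} :=
        (measurableSet_eq_fun measurable_fst measurable_snd).compl
      refine (Measure.ae_prod_iff_ae_ae hms).2 (Eventually.of_forall fun x => ?_)
      have : ∀ᵐ y ∂(labelsLaw D), y ≠ x := by simp [ae_iff]
      exact this.mono fun y hy => hy.symm
    rw [← hmap] at hdiag
    exact ae_of_ae_map (p := fun x : Labels D × Labels D => x.1 ≠ x.2) (by fun_prop) hdiag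
  have hall : ∀ᵐ u ∂(envLaw D), ∀ i k : ℕ, i ≠ k → u i ≠ u k := by
    simp only [ae_all_iff]
    exact hpair
  exact hall.mono fun u hu i k => not_imp_not.1 (hu i k)

theorem quenchedLimitPts_subset {u : Env D} (hu : IsTypicalEnv u) :
    quenchedLimitPts u ⊆ singleEdgeLaws D := by
  rintro ν ⟨κ, hκ, h⟩
  obtain ⟨j, hj⟩ := h.exists
  exact hu.limitPts_subset j hj

theorem quenchedLimitPtsIndependent_subset {u : Env D} (hu : IsTypicalEnv u) :
    quenchedLimitPtsIndependent u ⊆ singleEdgeLaws D := by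
  rintro ν ⟨p, hp, h⟩
  obtain ⟨j, hj⟩ := h.exists
  exact hu.limitPts_subset j hj

theorem quenchedLimitPtsIid_subset_independent (u : Env D) :
    quenchedLimitPtsIid u ⊆ quenchedLimitPtsIndependent u := by
  rintro ν ⟨p, hp, h⟩
  exact ⟨fun _ => p, fun _ => hp, h⟩

theorem limitPts_subset_quenchedLimitPts (u : Env D) (j : Indices D) :
    limitPts u j ⊆ quenchedLimitPts u := by
  intro ν hν
  refine ⟨Kernel.const _ (Measure.dirac j), inferInstance, ?_⟩
  simpa [ae_dirac_eq] using hν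

/-- As the label vectors are distinct, a deterministic rule can read off the trial `i` from `u i`
and answer `j i`. The same rule in every trial thus reproduces any prescribed sequence. -/
theorem limitPts_subset_quenchedLimitPtsIid {u : Env D} (hu : Function.Injective u)
    (j : Indices D) : limitPts u j ⊆ quenchedLimitPtsIid u := by
  intro ν hν
  -- The rule is arbitrary, here `j 0`, off the countable range of `u`.
  have hext : Measurable (Function.extend u j fun _ => j 0) :=
    (Measurable.measurableEmbedding (measurable_from_nat (f := u)) hu).measurable_extend
      measurable_from_nat measurable_const
  refine ⟨Kernel.deterministic _ hext, inferInstance, ?_⟩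
  simp only [Kernel.deterministic_apply, hu.extend_apply]
  rw [Measure.infinitePi_dirac]
  simpa [ae_dirac_eq] using hν

theorem ae_quenchedLimitPts_eq (hD : 1 ≤ D) :
    ∀ᵐ u ∂(envLaw D), quenchedLimitPts u = singleEdgeLaws D ∧
      quenchedLimitPtsIndependent u = singleEdgeLaws D ∧
      quenchedLimitPtsIid u = singleEdgeLaws D := by
  filter_upwards [ae_isTypicalEnv, ae_injective_env hD, ae_exists_limitPts hD]
    with u hu hinj ⟨j, hj⟩
  have hiid := hj.trans (limitPts_subset_quenchedLimitPtsIid hinj j)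
  have hsub := quenchedLimitPtsIid_subset_independent u
  exact ⟨(quenchedLimitPts_subset hu).antisymm (hj.trans (limitPts_subset_quenchedLimitPts u j)),
    (quenchedLimitPtsIndependent_subset hu).antisymm (hiid.trans hsub),
    (hsub.trans (quenchedLimitPtsIndependent_subset hu)).antisymm hiid⟩

/-- The block strategy alone fills the first two unions. An i.i.d. strategy converges to its own law
outside a null set that depends on the strategy, so only countably many can be treated together;
their laws are dense, whence the closure in the third set. -/
theorem ae_iUnion_limitPts_eq (hD : 1 ≤ D) {Ω : Type*} [MeasurableSpace Ω] {P : Measure Ω}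
    {U : Ω → Env D} {J : Measure (Env D × Indices D) → Ω → Indices D}
    (h : ∀ χ ∈ strategies D, HasLaw (fun ω => (U ω, J χ ω)) χ P) :
    ∀ᵐ ω ∂P,
      (⋃ χ ∈ strategies D, limitPts (U ω) (J χ ω)) = singleEdgeLaws D ∧
      (⋃ χ ∈ independentStrategies D, limitPts (U ω) (J χ ω)) = singleEdgeLaws D ∧
      closure (⋃ χ ∈ iidStrategies D, limitPts (U ω) (J χ ω)) = singleEdgeLaws D := by
  have transfer : ∀ χ ∈ strategies D, ∀ {p : Env D × Indices D → Prop}, (∀ᵐ x ∂χ, p x) →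
      ∀ᵐ ω ∂P, p (U ω, J χ ω) := by
    intro χ hχ p hp
    rw [← (h χ hχ).map_eq] at hp
    exact ae_of_ae_map (h χ hχ).aemeasurable hp
  obtain ⟨χ, hχ, hlim⟩ := exists_independent_limitPts hD
  obtain ⟨ψ, ν, hψ, hν, hdense⟩ := exists_dense_singleEdgeLaws hD
  have hχs := independentStrategies_subset hχ
  -- The environment `U` is shared, so typicality obtained from this one strategy bounds the limit
  -- points of all of them at once, although there are uncountably many.
  have htyp : ∀ᵐ x ∂χ, IsTypicalEnv x.1 := by
    refine ae_of_ae_map measurable_fst.aemeasurable ?_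
    rw [hχs.2]
    exact ae_isTypicalEnv
  have hiid : ∀ k, (productStrategy fun _ => ψ k) ∈ iidStrategies D := fun k =>
    ⟨ψ k, hψ k, rfl⟩
  have hk := ae_all_iff.2 fun k => transfer _
    (independentStrategies_subset (iidStrategies_subset (hiid k)))
    (ae_tendsto_of_iid (hψ k) (hν k))
  filter_upwards [transfer χ hχs htyp, transfer χ hχs hlim, hk] with ω hty hω hωk
  have hsub : ∀ C : Set (Measure (Env D × Indices D)),
      (⋃ χ ∈ C, limitPts (U ω) (J χ ω)) ⊆ singleEdgeLaws D := fun C =>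
    Set.iUnion₂_subset fun χ _ => hty.limitPts_subset _
  have hmem : ∀ C : Set (Measure (Env D × Indices D)), χ ∈ C →
      singleEdgeLaws D ⊆ ⋃ χ ∈ C, limitPts (U ω) (J χ ω) := fun C hC =>
    hω.trans (Set.subset_iUnion₂ (s := fun χ _ => limitPts (U ω) (J χ ω)) χ hC)
  refine ⟨(hsub _).antisymm (hmem _ hχs), (hsub _).antisymm (hmem _ hχ),
    (closure_minimal (hsub _) isClosed_singleEdgeLaws).antisymm
      (hdense.trans (closure_mono ?_))⟩
  rintro _ ⟨k, rfl⟩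
  exact Set.mem_iUnion₂.2 ⟨_, hiid k, id, strictMono_id, hωk k⟩

theorem almostSureLimitPts_mono {C C' : Set (Measure (Env D × Indices D))} (h : C ⊆ C') :
    almostSureLimitPts C ⊆ almostSureLimitPts C' := by
  rintro ν ⟨χ, hχ, hν⟩
  exact ⟨χ, h hχ, hν⟩

theorem almostSureLimitPts_strategies_subset :
    almostSureLimitPts (strategies D) ⊆ singleEdgeLaws D := by
  rintro ν ⟨χ, hχ, hν⟩
  have := hχ.1
  have htyp : ∀ᵐ x ∂χ, IsTypicalEnv x.1 := by
    refine ae_of_ae_map measurable_fst.aemeasurable ?_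
    rw [hχ.2]
    exact ae_isTypicalEnv
  obtain ⟨x, hx, hxν⟩ := (htyp.and hν).exists
  exact hx.limitPts_subset _ hxν

theorem singleEdgeLaws_subset_almostSureLimitPts_iid :
    singleEdgeLaws D ⊆ almostSureLimitPts (iidStrategies D) := by
  rintro ν ⟨ψ, hψ, hν⟩
  exact ⟨_, ⟨ψ, hψ, rfl⟩, (ae_tendsto_of_iid hψ hν).mono fun x hx => ⟨id, strictMono_id, hx⟩⟩

end LimitPoints

theorem theoremA (D : ℕ) (hD : 1 ≤ D) :
    -- the deterministic sets coincide and are weakly closed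
    (finiteGridEntropy D = firstChoiceLaws D ∧
      finiteGridEntropy D = singleEdgeLaws D ∧
      IsClosed (singleEdgeLaws D)) ∧
    -- for almost every environment, the limit points given this environment form the same set
    (∀ᵐ u ∂(envLaw D),
      quenchedLimitPts u = finiteGridEntropy D ∧
      quenchedLimitPtsIndependent u = finiteGridEntropy D ∧
      quenchedLimitPtsIid u = finiteGridEntropy D) ∧
    -- the same for the random sets of limit points, when all strategies are realized on one
    -- probability space with a common environment
    (∀ (Ω : Type*) [MeasurableSpace Ω] (P : Measure Ω) [IsProbabilityMeasure P]
      (U : Ω → Env D) (J : Measure (Env D × Indices D) → Ω → Indices D),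
      (∀ χ ∈ strategies D, HasLaw (fun ω => (U ω, J χ ω)) χ P) →
      ∀ᵐ ω ∂P,
        (⋃ χ ∈ strategies D, limitPts (U ω) (J χ ω)) = finiteGridEntropy D ∧
        (⋃ χ ∈ independentStrategies D, limitPts (U ω) (J χ ω)) = finiteGridEntropy D ∧
        closure (⋃ χ ∈ iidStrategies D, limitPts (U ω) (J χ ω)) = finiteGridEntropy D) ∧
    -- the same for the almost sure limit points of individual strategies
    (almostSureLimitPts (strategies D) = finiteGridEntropy D ∧
      almostSureLimitPts (independentStrategies D) = finiteGridEntropy D ∧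
      almostSureLimitPts (iidStrategies D) = finiteGridEntropy D) := by
  rw [finiteGridEntropy_eq_singleEdgeLaws hD]
  have hind := almostSureLimitPts_mono (iidStrategies_subset (D := D))
  have hstr := almostSureLimitPts_mono (independentStrategies_subset (D := D))
  have hiid := singleEdgeLaws_subset_almostSureLimitPts_iid (D := D)
  have hsub := almostSureLimitPts_strategies_subset (D := D)
  exact ⟨⟨firstChoiceLaws_eq_singleEdgeLaws.symm, rfl, isClosed_singleEdgeLaws⟩,
    ae_quenchedLimitPts_eq hD,
    fun Ω _ P _ U J h => ae_iUnion_limitPts_eq hD h,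
    hsub.antisymm (hiid.trans (hind.trans hstr)),
    (hstr.trans hsub).antisymm (hiid.trans hind),
    (hind.trans (hstr.trans hsub)).antisymm hiid⟩
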